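/- Write $\log$ for the logarithm to base $2$ and $\ln$ for the natural logarithm. For integers $u\ge\ell\ge1$, a set $S\subseteq\mathbb F_2^u$ with $|S|=2^\ell$ and a linear map $h:\mathbb F_2^u\to\mathbb F_2^\ell$, let \[ \mathsf M(S,h):=\max_{y\in\mathbb F_2^\ell}\,|h^{-1}(y)\cap S| \] be the maximum load, and let $\mathbb E_h[\mathsf M(S,h)]$ be its expectation when $h$ is uniformly distributed over all linear maps $\mathbb F_2^u\to\mathbb F_2^\ell$. Then there is a function $\varepsilon:\mathbb N\to\mathbb R$ with $\varepsilon(\ell)\to0$ as $\ell\to\infty$ such that, for all sufficiently large $\ell$, every $u\ge\ell$ and every $S\subseteq\mathbb F_2^u$ of size $2^\ell$, \[ \mathbb E_h[\mathsf M(S,h)]\le\left(1+(1+\varepsilon(\ell))\frac{\ln\ln\ell}{\ln\ell}\right)\frac{\ell}{\log\ell}. \] Equivalently, with $n=2^\ell$ and (possibly different) functions $\varepsilon(\ell)\to0$ that again depend on $\ell$ alone, for all sufficiently large $\ell$ and all such $u$ and $S$, \[ \mathbb E_h[\mathsf M(S,h)]\le\left(1+(1+\varepsilon(\ell))\frac{\log\log\log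 n}{\log\log n}\right)\frac{\log n}{\log\log n}, \] that is, \[ \mathbb E_h[\mathsf M(S,h)]\le\frac{\log n}{\log\log n}+(1+\varepsilon(\ell))\frac{\log n\cdot\log\log\log n}{(\log\log n)^2}. \] -/

import Mathlib

open Filter Topology

noncomputable section

namespace LinearHash

/-- The vector space `F_2^d`. -/
abbrev F2 (d : ℕ) : Type := Fin d → ZMod 2

/-- There are finitely many linear maps `F_2^u → F_2^ℓ`. -/
instance fintypeLinearMap (u ℓ : ℕ) : Fintype (F2 u →ₗ[ZMod 2] F2 ℓ) :=
  DFunLike.fintype _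

/-- The load `|h⁻¹(y) ∩ S|` of the bin `y`: the number of keys of `S` hashed to `y`. -/
def load {u ℓ : ℕ} (S : Finset (F2 u)) (h : F2 u →ₗ[ZMod 2] F2 ℓ) (y : F2 ℓ) : ℕ :=
  (S.filter fun x => h x = y).card

/-- The maximum load `M(S, h) = max_y |h⁻¹(y) ∩ S|` over all bins `y ∈ F_2^ℓ`. -/
def maxLoad {u ℓ : ℕ} (S : Finset (F2 u)) (h : F2 u →ₗ[ZMod 2] F2 ℓ) : ℕ :=
  Finset.univ.sup' Finset.univ_nonempty (load S h)

/-- The expectation of `M(S, h)` when `h` is drawn uniformly from the finite set of all linear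
maps `F_2^u → F_2^ℓ` (not only the surjective ones): the average of `M(S, h)` over that set. -/
def expectedMaxLoad {u : ℕ} (ℓ : ℕ) (S : Finset (F2 u)) : ℝ :=
  (∑ h : F2 u →ₗ[ZMod 2] F2 ℓ, (maxLoad S h : ℝ)) /
    (Fintype.card (F2 u →ₗ[ZMod 2] F2 ℓ) : ℝ)

/-- A bound on the expected maximum load that holds, for every sufficiently large `ℓ`, for all
`u ≥ ℓ` and all sets of `2 ^ ℓ` keys in `F_2^u`. The bound `B` depends on `ℓ` alone. -/
def EventuallyExpectedMaxLoadLE (B : ℕ → ℝ) : Prop :=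
  ∀ᶠ ℓ : ℕ in atTop, ∀ u : ℕ, ℓ ≤ u → ∀ S : Finset (F2 u), S.card = 2 ^ ℓ →
    expectedMaxLoad ℓ S ≤ B ℓ

end LinearHash

end

/-!
Let `W = F_2^ℓ` and write `𝔼` for averages over finite types. A uniform linear map
`h : F_2^u → W` is `x ↦ ∑ i, x i • c i` with independent uniform columns `c i ∈ W`. The heart of
the proof is the inequality `expect_log_expect_prod_le`: for every positive `G : F_2^u → W → ℝ`,
`𝔼_c log 𝔼_y ∏_x G x (y + ∑ i, x i • c i) ≤ ∑_x log 𝔼_y G x y`.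
It is proved one column at a time. The first column `v` merges the functions `a = G (0, x')` and
`b = G (1, x')` into `y ↦ a y * b (y + v)`, whose mean over both `y` and `v` is the product of the
means of `a` and `b`; as `log` is concave, averaging over `v` can only decrease the sum of the
logarithms of the means.

With `G x y = exp t` for `x ∈ S`, `y = 0`, and `G x y = 1` otherwise, the product is
`exp (t * load)`, and the right-hand side is `|S| * log (1 + 2^(-ℓ) * (exp t - 1)) ≤ exp t - 1`,
the value that independent Poisson loads of mean one would give. Since
`exp (t * maxLoad) ≤ 2^ℓ * 𝔼_y exp (t * load y)`, this gives `mul_expectedMaxLoad_le`: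
`t * 𝔼 maxLoad ≤ ℓ * ln 2 + exp t - 1` for every `t ≥ 0`. The choice `t = ln ℓ - ln ln ℓ`, for
which `exp t = ℓ / ln ℓ`, yields the bound, with an explicit error term.
-/
namespace LinearHash

open Finset
open scoped BigOperators

/-! ### Averages over columns and over the cube -/

theorem expect_log_le_log_expect {ι : Type*} [Fintype ι] [Nonempty ι] (f : ι → ℝ)
    (hf : ∀ i, 0 < f i) : 𝔼 i, Real.log (f i) ≤ Real.log (𝔼 i, f i) := by
  have hcard : (Fintype.card ι : ℝ) ≠ 0 := Nat.cast_ne_zero.2 Fintype.card_ne_zero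
  have h := strictConcaveOn_log_Ioi.concaveOn.le_map_sum (t := (univ : Finset ι))
    (w := fun _ => (Fintype.card ι : ℝ)⁻¹) (p := f) (fun _ _ => by positivity)
    (by simp [hcard]) (fun i _ => hf i)
  simpa only [Fintype.expect_eq_sum_div_card, div_eq_inv_mul, smul_eq_mul, mul_sum] using h

theorem expect_pi_fin_succ {W : Type*} [Fintype W] (n : ℕ) (F : (Fin (n + 1) → W) → ℝ) :
    𝔼 c, F c = 𝔼 v : W, 𝔼 c : Fin n → W, F (Fin.cons v c) := by
  rw [← Finset.expect_product', univ_product_univ]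
  exact (Fintype.expect_equiv (Fin.consEquiv fun _ : Fin (n + 1) => W)
    (fun p => F (Fin.cons p.1 p.2)) F fun _ => rfl).symm

theorem univ_zmod_two : (univ : Finset (ZMod 2)) = {0, 1} := rfl

theorem prod_F2_succ {M : Type*} [CommMonoid M] (n : ℕ) (F : F2 (n + 1) → M) :
    ∏ x, F x = ∏ x : F2 n, F (Fin.cons 0 x) * F (Fin.cons 1 x) := by
  rw [← (Fin.consEquiv fun _ : Fin (n + 1) => ZMod 2).prod_comp F, Fintype.prod_prod_type_right]
  refine prod_congr rfl fun x _ => ?_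
  rw [univ_zmod_two, prod_pair (by decide)]
  rfl

theorem sum_F2_succ {M : Type*} [AddCommMonoid M] (n : ℕ) (F : F2 (n + 1) → M) :
    ∑ x, F x = ∑ x : F2 n, (F (Fin.cons 0 x) + F (Fin.cons 1 x)) :=
  prod_F2_succ (M := Multiplicative M) n F

/-! ### The logarithmic potential does not increase -/

theorem expect_mul_translate {W : Type*} [AddCommGroup W] [Fintype W] (a b : W → ℝ) :
    𝔼 v, 𝔼 y, a y * b (y + v) = (𝔼 y, a y) * 𝔼 y, b y := by
  rw [expect_comm, expect_mul]
  refine expect_congr rfl fun y _ => ?_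
  rw [← mul_expect]
  congr 1
  exact Fintype.expect_equiv (Equiv.addLeft y) _ _ fun _ => rfl

/-- Adding the columns `c i` one at a time does not increase the expected sum of the logarithms
of the means: each step is Jensen's inequality for `log`, after `expect_mul_translate`. -/
theorem expect_log_expect_prod_le {W : Type*} [AddCommGroup W] [Module (ZMod 2) W] [Fintype W] :
    ∀ (u : ℕ) (G : F2 u → W → ℝ), (∀ x y, 0 < G x y) →
      𝔼 c : Fin u → W, Real.log (𝔼 y, ∏ x, G x (y + ∑ i, x i • c i)) ≤
        ∑ x, Real.log (𝔼 y, G x y) := by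
  intro u
  induction u with
  | zero =>
    intro G _
    simp
  | succ n ih =>
    intro G hG
    have hpos : ∀ (x : F2 (n + 1)), 0 < 𝔼 y, G x y := fun x =>
      expect_pos (fun y _ => hG x y) univ_nonempty
    have hpos' : ∀ (x : F2 n) (v : W),
        0 < 𝔼 y, G (Fin.cons 0 x) y * G (Fin.cons 1 x) (y + v) := fun x v =>
      expect_pos (fun y _ => mul_pos (hG _ _) (hG _ _)) univ_nonempty
    have hstep : ∀ v : W, 𝔼 c : Fin n → W, Real.log (𝔼 y, ∏ x : F2 n,
          (G (Fin.cons 0 x) (y + ∑ i, x i • c i) * G (Fin.cons 1 x) (y + ∑ i, x i • c i + v))) ≤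
        ∑ x : F2 n, Real.log (𝔼 y, G (Fin.cons 0 x) y * G (Fin.cons 1 x) (y + v)) := fun v =>
      ih (fun x y => G (Fin.cons 0 x) y * G (Fin.cons 1 x) (y + v))
        fun x y => mul_pos (hG _ _) (hG _ _)
    calc 𝔼 c : Fin (n + 1) → W, Real.log (𝔼 y, ∏ x, G x (y + ∑ i, x i • c i))
        = 𝔼 v : W, 𝔼 c : Fin n → W, Real.log (𝔼 y, ∏ x : F2 n,
            (G (Fin.cons 0 x) (y + ∑ i, x i • c i) *
              G (Fin.cons 1 x) (y + ∑ i, x i • c i + v))) := by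
          rw [expect_pi_fin_succ]
          refine expect_congr rfl fun v _ => expect_congr rfl fun c _ => ?_
          congr 1
          refine expect_congr rfl fun y _ => ?_
          rw [prod_F2_succ]
          refine prod_congr rfl fun x _ => ?_
          simp only [Fin.sum_univ_succ, Fin.cons_zero, Fin.cons_succ, zero_smul, zero_add, one_smul]
          congr 2
          abel
      _ ≤ 𝔼 v : W, ∑ x : F2 n,
            Real.log (𝔼 y, G (Fin.cons 0 x) y * G (Fin.cons 1 x) (y + v)) :=
          expect_le_expect fun v _ => hstep v
      _ = ∑ x : F2 n, 𝔼 v : W,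
            Real.log (𝔼 y, G (Fin.cons 0 x) y * G (Fin.cons 1 x) (y + v)) :=
          expect_sum_comm _ _ _
      _ ≤ ∑ x : F2 n, Real.log (𝔼 v : W, 𝔼 y, G (Fin.cons 0 x) y * G (Fin.cons 1 x) (y + v)) :=
          sum_le_sum fun x _ => expect_log_le_log_expect _ fun v => hpos' x v
      _ = ∑ x, Real.log (𝔼 y, G x y) := by
          rw [sum_F2_succ]
          refine sum_congr rfl fun x _ => ?_
          rw [expect_mul_translate, Real.log_mul (hpos _).ne' (hpos _).ne']

/-! ### The exponential moment of the loads -/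

/-- A uniform linear map is given by independent uniform images of the basis vectors. -/
theorem expect_linearMap {u ℓ : ℕ} (F : (F2 u →ₗ[ZMod 2] F2 ℓ) → ℝ) :
    𝔼 h, F h = 𝔼 c : Fin u → F2 ℓ, F (Fintype.linearCombination (ZMod 2) c) := by
  refine (Fintype.expect_equiv ((Pi.basisFun (ZMod 2) (Fin u)).constr ℕ).toEquiv _ F
    fun c => ?_).symm
  congr 1
  refine (Pi.basisFun (ZMod 2) (Fin u)).ext fun i => ?_
  simp [Fintype.linearCombination_apply, Module.Basis.constr_apply_fintype]

theorem expect_log_expect_exp_load_le {u ℓ : ℕ} (S : Finset (F2 u)) (hS : S.card = 2 ^ ℓ)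
    {t : ℝ} (ht : 0 ≤ t) :
    𝔼 h : F2 u →ₗ[ZMod 2] F2 ℓ, Real.log (𝔼 y, Real.exp (t * load S h y)) ≤ Real.exp t - 1 := by
  classical
  rw [expect_linearMap]
  have key := expect_log_expect_prod_le (W := F2 ℓ) u
    (fun x y => if x ∈ S ∧ y = 0 then Real.exp t else 1)
    (fun x y => by split_ifs <;> positivity)
  have hload : ∀ (c : Fin u → F2 ℓ) (y : F2 ℓ),
      Real.exp (t * load S (Fintype.linearCombination (ZMod 2) c) y) =
        ∏ x : F2 u, if x ∈ S ∧ -y + ∑ i, x i • c i = 0 then Real.exp t else 1 := by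
    intro c y
    rw [← prod_filter, prod_const, ← Real.exp_nat_mul, mul_comm, load]
    congr 4
    ext x
    rw [mem_filter, mem_filter, Fintype.linearCombination_apply, neg_add_eq_zero,
      eq_comm (a := y)]
    simp
  have hneg : ∀ c : Fin u → F2 ℓ,
      𝔼 y, Real.exp (t * load S (Fintype.linearCombination (ZMod 2) c) y) =
        𝔼 y, ∏ x : F2 u, if x ∈ S ∧ y + ∑ i, x i • c i = 0 then Real.exp t else 1 := fun c =>
    Fintype.expect_equiv (Equiv.neg _) _ _ fun y => hload c y
  -- The bin `y` is compared with the shift `-y`, which is harmless under the average over `y`.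
  simp only [hneg]
  refine key.trans ?_
  have hcell : ∀ x : F2 u, Real.log (𝔼 y : F2 ℓ, if x ∈ S ∧ y = 0 then Real.exp t else 1) ≤
      if x ∈ S then (Real.exp t - 1) / 2 ^ ℓ else 0 := by
    intro x
    split_ifs with hx
    · have hE : 𝔼 y : F2 ℓ, (if x ∈ S ∧ y = 0 then Real.exp t else 1) =
          1 + (Real.exp t - 1) / 2 ^ ℓ := by
        have hsplit : ∀ y : F2 ℓ, (if x ∈ S ∧ y = 0 then Real.exp t else 1) =
            1 + if y = 0 then Real.exp t - 1 else 0 := by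
          intro y
          by_cases hy : y = 0 <;> simp [hx, hy]
        simp only [hsplit, expect_add_distrib, expect_const univ_nonempty]
        rw [Fintype.expect_eq_sum_div_card]
        simp
      have h1 : 0 ≤ (Real.exp t - 1) / 2 ^ ℓ :=
        div_nonneg (sub_nonneg.2 (Real.one_le_exp ht)) (by positivity)
      rw [hE]
      linarith [Real.log_le_sub_one_of_pos (by linarith : 0 < 1 + (Real.exp t - 1) / 2 ^ ℓ)]
    · simp [hx]
  refine (sum_le_sum fun x _ => hcell x).trans (le_of_eq ?_)
  rw [← sum_filter, sum_const, filter_univ_mem, hS, nsmul_eq_mul]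
  push_cast
  field_simp

/-- The maximum load is controlled by the exponential moment of the load of a uniform bin: one
term of a sum of positive terms is at most the sum. -/
theorem mul_maxLoad_le {u ℓ : ℕ} (S : Finset (F2 u)) (h : F2 u →ₗ[ZMod 2] F2 ℓ) (t : ℝ) :
    t * maxLoad S h ≤ ℓ * Real.log 2 + Real.log (𝔼 y, Real.exp (t * load S h y)) := by
  obtain ⟨y₀, -, hy₀⟩ := exists_mem_eq_sup' (univ_nonempty (α := F2 ℓ)) (load S h)
  have hpos : 0 < 𝔼 y, Real.exp (t * load S h y) :=
    expect_pos (fun y _ => Real.exp_pos _) univ_nonempty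
  have hle : Real.exp (t * maxLoad S h) ≤ 2 ^ ℓ * 𝔼 y, Real.exp (t * load S h y) := by
    have hsum : 2 ^ ℓ * 𝔼 y, Real.exp (t * load S h y) = ∑ y, Real.exp (t * load S h y) := by
      simp [Fintype.expect_eq_sum_div_card, mul_div_cancel₀]
    rw [hsum, maxLoad, hy₀]
    exact single_le_sum (f := fun y => Real.exp (t * load S h y))
      (fun y _ => (Real.exp_pos _).le) (mem_univ y₀)
  have hlog := (Real.le_log_iff_exp_le (by positivity)).2 hle
  rwa [Real.log_mul (by positivity) hpos.ne', Real.log_pow] at hlog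

theorem mul_expectedMaxLoad_le {u ℓ : ℕ} (S : Finset (F2 u)) (hS : S.card = 2 ^ ℓ)
    {t : ℝ} (ht : 0 ≤ t) :
    t * expectedMaxLoad ℓ S ≤ ℓ * Real.log 2 + (Real.exp t - 1) := by
  rw [expectedMaxLoad, ← Fintype.expect_eq_sum_div_card, mul_expect]
  refine (expect_le_expect fun h _ => mul_maxLoad_le S h t).trans ?_
  rw [expect_add_distrib, expect_const univ_nonempty]
  gcongr
  exact expect_log_expect_exp_load_le S hS ht

/-! ### The choice of the parameter -/

/-- The error term `ε`. With `r = ln ln ℓ / ln ℓ` it is the solution of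
`(ℓ ln 2 + ℓ / ln ℓ) / (ln ℓ - ln ln ℓ) = (1 + (1 + ε) r) * (ℓ ln 2 / ln ℓ)`, whose left-hand side is
the bound on the expected maximum load obtained from `t = ln ℓ - ln ln ℓ`. -/
noncomputable def errorTerm (ℓ : ℕ) : ℝ :=
  (1 + 1 / (Real.log 2 * Real.log (Real.log ℓ))) /
    (1 - Real.log (Real.log ℓ) / Real.log ℓ) - 1

theorem tendsto_log_natCast : Tendsto (fun ℓ : ℕ => Real.log ℓ) atTop atTop :=
  Real.tendsto_log_atTop.comp tendsto_natCast_atTop_atTop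

theorem tendsto_loglog_div_log :
    Tendsto (fun ℓ : ℕ => Real.log (Real.log ℓ) / Real.log ℓ) atTop (𝓝 0) :=
  Real.isLittleO_log_id_atTop.tendsto_div_nhds_zero.comp tendsto_log_natCast

theorem tendsto_errorTerm : Tendsto errorTerm atTop (𝓝 0) := by
  have hLL : Tendsto (fun ℓ : ℕ => Real.log 2 * Real.log (Real.log ℓ)) atTop atTop :=
    (Real.tendsto_log_atTop.comp tendsto_log_natCast).const_mul_atTop (Real.log_pos one_lt_two)
  have h : Tendsto errorTerm atTop (𝓝 ((1 + 0) / (1 - 0) - 1)) :=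
    ((((tendsto_const_nhds (x := (1 : ℝ))).div_atTop hLL).const_add 1).div
    (tendsto_loglog_div_log.const_sub 1) (by norm_num)).sub_const 1
  simpa only [add_zero, sub_zero, div_one, sub_self] using h

theorem eventually_loglog_pos_and_lt_log :
    ∀ᶠ ℓ : ℕ in atTop, 0 < Real.log ℓ ∧ 0 < Real.log (Real.log ℓ) ∧
      Real.log (Real.log ℓ) < Real.log ℓ := by
  filter_upwards [tendsto_log_natCast.eventually_gt_atTop 1] with ℓ h
  exact ⟨by linarith, Real.log_pos h,
    by linarith [Real.log_le_sub_one_of_pos (show 0 < Real.log ℓ by linarith)]⟩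

theorem eventually_expectedMaxLoad_le : EventuallyExpectedMaxLoadLE fun ℓ : ℕ =>
    (1 + (1 + errorTerm ℓ) * (Real.log (Real.log (ℓ : ℝ)) / Real.log (ℓ : ℝ))) *
      ((ℓ : ℝ) / Real.logb 2 (ℓ : ℝ)) := by
  filter_upwards [eventually_loglog_pos_and_lt_log, eventually_gt_atTop 0]
    with ℓ ⟨hL, hLL, hlt⟩ hℓ u _ S hS
  have hℓ' : (0 : ℝ) < ℓ := Nat.cast_pos.2 hℓ
  have h2 : 0 < Real.log 2 := Real.log_pos one_lt_two
  have ht : 0 < Real.log ℓ - Real.log (Real.log ℓ) := sub_pos.2 hlt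
  -- `t = ln ℓ - ln ln ℓ`, so that `exp t = ℓ / ln ℓ` is negligible against `ℓ ln 2`.
  have hmain := mul_expectedMaxLoad_le S hS ht.le
  rw [Real.exp_sub, Real.exp_log hℓ', Real.exp_log hL, mul_comm] at hmain
  have hle : expectedMaxLoad ℓ S ≤
      (ℓ * Real.log 2 + ℓ / Real.log ℓ) / (Real.log ℓ - Real.log (Real.log ℓ)) :=
    (le_div_iff₀ ht).2 (by linarith)
  refine hle.trans (le_of_eq ?_)
  rw [errorTerm, Real.logb]
  have hr : 1 - Real.log (Real.log ℓ) / Real.log ℓ =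
      (Real.log ℓ - Real.log (Real.log ℓ)) / Real.log ℓ := by
    field_simp
  rw [hr]
  generalize Real.log (Real.log ℓ) = M at *
  generalize Real.log (ℓ : ℝ) = L at *
  have hne := ht.ne'
  field_simp
  ring

/-- The same error term serves for base `2`: as `ln 2 < 1`, replacing the iterated natural
logarithms by logarithms to base `2` only increases the ratio that it multiplies. -/
theorem eventually_expectedMaxLoad_le_logb : EventuallyExpectedMaxLoadLE fun ℓ : ℕ =>
    let n : ℝ := (2 : ℝ) ^ ℓ
    (1 + (1 + errorTerm ℓ) *
        (Real.logb 2 (Real.logb 2 (Real.logb 2 n)) / Real.logb 2 (Real.logb 2 n))) *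
      (Real.logb 2 n / Real.logb 2 (Real.logb 2 n)) := by
  filter_upwards [eventually_expectedMaxLoad_le, eventually_loglog_pos_and_lt_log,
    tendsto_errorTerm.eventually_const_lt (show (-1 : ℝ) < 0 by norm_num)]
    with ℓ h ⟨hL, hLL, _⟩ hε u hu S hS
  refine (h u hu S hS).trans ?_
  have h2 : 0 < Real.log 2 := Real.log_pos one_lt_two
  have hn : Real.logb 2 ((2 : ℝ) ^ ℓ) = ℓ := by
    rw [Real.logb_pow, Real.logb_self_eq_one one_lt_two, mul_one]
  have hlogb : Real.log ℓ ≤ Real.logb 2 ℓ :=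
    le_div_self hL.le h2 (by linarith [Real.log_two_lt_d9])
  have hratio : Real.logb 2 (Real.logb 2 ℓ) / Real.logb 2 ℓ =
      Real.log (Real.logb 2 ℓ) / Real.log ℓ := by
    simp only [Real.logb]
    exact div_div_div_cancel_right₀ h2.ne' _ _
  simp only [hn, hratio]
  have hε' : 0 ≤ 1 + errorTerm ℓ := by linarith
  have : 0 ≤ Real.logb 2 ℓ := hL.le.trans hlogb
  gcongr

end LinearHash

theorem corollary3p8 :
    (∃ ε : ℕ → ℝ, Tendsto ε atTop (𝓝 0) ∧
      LinearHash.EventuallyExpectedMaxLoadLE fun ℓ : ℕ =>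
        (1 + (1 + ε ℓ) * (Real.log (Real.log (ℓ : ℝ)) / Real.log (ℓ : ℝ))) *
          ((ℓ : ℝ) / Real.logb 2 (ℓ : ℝ))) ∧
    (∃ ε : ℕ → ℝ, Tendsto ε atTop (𝓝 0) ∧
      LinearHash.EventuallyExpectedMaxLoadLE fun ℓ : ℕ =>
        let n : ℝ := (2 : ℝ) ^ ℓ
        (1 + (1 + ε ℓ) *
            (Real.logb 2 (Real.logb 2 (Real.logb 2 n)) / Real.logb 2 (Real.logb 2 n))) *
          (Real.logb 2 n / Real.logb 2 (Real.logb 2 n))) ∧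
    (∃ ε : ℕ → ℝ, Tendsto ε atTop (𝓝 0) ∧
      LinearHash.EventuallyExpectedMaxLoadLE fun ℓ : ℕ =>
        let n : ℝ := (2 : ℝ) ^ ℓ
        Real.logb 2 n / Real.logb 2 (Real.logb 2 n) +
          (1 + ε ℓ) * (Real.logb 2 n * Real.logb 2 (Real.logb 2 (Real.logb 2 n)) /
            (Real.logb 2 (Real.logb 2 n)) ^ 2)) := by
  refine ⟨⟨_, LinearHash.tendsto_errorTerm, LinearHash.eventually_expectedMaxLoad_le⟩,
    ⟨_, LinearHash.tendsto_errorTerm, LinearHash.eventually_expectedMaxLoad_le_logb⟩,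
    ⟨_, LinearHash.tendsto_errorTerm, ?_⟩⟩
  filter_upwards [LinearHash.eventually_expectedMaxLoad_le_logb] with ℓ h u hu S hS
  refine (h u hu S hS).trans (le_of_eq ?_)
  ring
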